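/- Let $\gamma$ be Euler's constant, $\zeta$ the Riemann zeta function, $B_n$ the Bernoulli numbers, and let $A=1.28242\ldots$ be the Glaisher–Kinkelin constant, $\log A=\frac1{12}-\zeta'(-1)$. Write $f\sim g$ if $f(n)/g(n)\to1$ as $n\to\infty$. For real numbers $s$ and $a_2,a_3,\dots$, we say that $s$ is given by the enveloping divergent series $\sum_{j\ge2}a_j$ if this series diverges and for every integer $m\ge2$ there is $\theta_m\in(0,1)$ with $$s=\sum_{j=2}^{m-1}a_j+\theta_m a_m .$$ There are positive constants $F_k$ ($k=1,2,3,\dots$) such that for every integer $k\ge1$ $$\prod_{\nu=1}^n (k\nu)!\;\sim\;F_k\,A^k\,(2\pi)^{1/4}\left(\frac{kn}{e^{3/2}}\right)^{\frac k2 n(n+1)}\left(2\pi k\,e^{k/2-1}\,n\right)^{n/2}n^{\frac14+\frac k{12}+\frac1{12k}}\qquad(n\to\infty),$$ and $\log F_k-\dfrac{\gamma}{12k}$ is given by the enveloping divergent series $$\sum_{j\ge2}\frac{B_{2j}\,\zeta(2j-1)}{2j(2j-1)\,k^{2j-1}} .$$ Moreover, $$\lim_{k\to\infty}F_k=1,\qquad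 \lim_{k\to\infty}F_k^{\,k}=e^{\gamma/12},$$ and there is a constant $F_\infty>0$ such that $$\prod_{k=1}^nF_k\;\sim\;F_\infty\,n^{\gamma/12}\qquad(n\to\infty),$$ and $\log F_\infty-\dfrac{\gamma^2}{12}$ is given by the enveloping divergent series $$\sum_{j\ge2}\frac{B_{2j}\,\zeta(2j-1)^2}{2j(2j-1)} .$$ -/

import Mathlib

open Filter Topology Asymptotics
open scoped Nat

/-- The Glaisher–Kinkelin constant `A = 1.2824271291…`, given by `log A = 1/12 - ζ'(-1)`
(the number `ζ'(-1)` is real). -/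
noncomputable def glaisherKinkelin : ℝ :=
  Real.exp (1 / 12 - (deriv riemannZeta (-1)).re)

/-- `IsEnvelopingDivergentSum j₀ a s`: the series `∑_{j ≥ j₀} a j` diverges and is an enveloping
expansion of the real number `s`, that is, for every truncation index `m ≥ j₀` the remainder
after the terms `j₀ ≤ j < m` is `θ * a m`, with a number `θ` strictly between `0` and `1`
(`θ` may depend on `m`). -/
def IsEnvelopingDivergentSum (j₀ : ℕ) (a : ℕ → ℝ) (s : ℝ) : Prop :=
  (¬ ∃ L : ℝ, Tendsto (fun m : ℕ => ∑ j ∈ Finset.Ico j₀ m, a j) atTop (𝓝 L)) ∧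
  ∀ m : ℕ, j₀ ≤ m → ∃ θ : ℝ, 0 < θ ∧ θ < 1 ∧
    s = (∑ j ∈ Finset.Ico j₀ m, a j) + θ * a m

/-- The real number `ζ(2j-1)`; it is used for `j ≥ 2`. -/
noncomputable def zetaOdd (j : ℕ) : ℝ := (riemannZeta (2 * (j : ℂ) - 1)).re

/-! Everything reduces to Stirling's series for `log N!` with remainders of known sign. The
increment in `N` of the remainder `stirlingTail m N` is an Euler–Maclaurin integral of sign `(-1) ^
(m + 1)`, and the remainder tends to `0`, so it has that sign itself
(`neg_one_pow_mul_stirlingTail_pos`). Signs survive summation, so summing over any family of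
integers with convergent power sums again gives an enveloping series, whose terms carry those power
sums (`isEnvelopingDivergentSum_tsum_stirlingTail`). The family `kν` gives `log F_k` and the family
of all products `kν` gives `log F_∞`; divergence comes from the growth of `B_{2j}`.

The terms of Stirling's formula outside the tail are summed exactly (`sum_log_factorial_mul`). The
term `1 / (12kν)` produces `γ`, and `∑ ν log ν` produces `ζ'(-1)`, by termwise differentiation of an
Euler–Maclaurin representation of `ζ` valid near `-1` (`tendsto_sum_mul_log`). -/

/-! ### Bernoulli numbers and polynomials -/

/-- A lower bound for `|B_{2m}|`, from the first term of the series of `ζ(2m)`. -/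
theorem bernoulli_two_mul_lower_bound {m : ℕ} (hm : m ≠ 0) :
    2 * ((2 * m)! : ℝ) / (2 * Real.pi) ^ (2 * m) ≤ (-1) ^ (m + 1) * (bernoulli (2 * m) : ℝ) := by
  have h := hasSum_one_div_nat_pow_mul_cos hm (x := 0) (by simp)
  have h1 := le_hasSum h 1 (fun n _ => by simp)
  have h0 : (Polynomial.map (algebraMap ℚ ℝ) (Polynomial.bernoulli (2 * m))).eval 0
      = (bernoulli (2 * m) : ℝ) := bernoulliFun_eval_zero (2 * m)
  rw [h0] at h1
  simp only [Nat.cast_one, one_pow, mul_zero, Real.cos_zero, mul_one, div_one] at h1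
  have hf : (0 : ℝ) < ((2 * m)! : ℝ) := by positivity
  rw [div_le_iff₀ (by positivity)]
  have h2 : (-1 : ℝ) ^ (m + 1) * (2 * Real.pi) ^ (2 * m) / 2 / ((2 * m)! : ℝ) * (bernoulli (2 * m) : ℝ)
      = ((-1) ^ (m + 1) * (bernoulli (2 * m) : ℝ) * (2 * Real.pi) ^ (2 * m)) / (2 * ((2 * m)! : ℝ)) := by
    field_simp
  rw [h2, le_div_iff₀ (by positivity)] at h1
  linarith

/-- An even Bernoulli polynomial is strictly dominated on `(0, 1)` by its value at `0`. -/
theorem neg_one_pow_mul_bernoulliFun_lt {m : ℕ} (hm : m ≠ 0) {t : ℝ} (ht : t ∈ Set.Ioo (0 : ℝ) 1) :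
    (-1) ^ (m + 1) * bernoulliFun (2 * m) t < (-1) ^ (m + 1) * (bernoulli (2 * m) : ℝ) := by
  have h := hasSum_one_div_nat_pow_mul_cos hm (x := 0) (by simp)
  have h' := hasSum_one_div_nat_pow_mul_cos hm (x := t) ⟨ht.1.le, ht.2.le⟩
  have h0 : (Polynomial.map (algebraMap ℚ ℝ) (Polynomial.bernoulli (2 * m))).eval 0
      = (bernoulli (2 * m) : ℝ) := bernoulliFun_eval_zero (2 * m)
  rw [h0] at h
  -- The cosine series at `t` and at `0` are compared termwise; the term of index `1` is strict
  -- because `cos (2πt) < 1` inside the interval.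
  have hlt := hasSum_lt (i := 1) (fun n => ?_) ?_ h' h
  · have hc : (0 : ℝ) < (2 * Real.pi) ^ (2 * m) / 2 / ((2 * m)! : ℝ) := by positivity
    refine lt_of_mul_lt_mul_left ?_ hc.le
    calc _ = (-1 : ℝ) ^ (m + 1) * (2 * Real.pi) ^ (2 * m) / 2 / ((2 * m)! : ℝ) *
          (Polynomial.map (algebraMap ℚ ℝ) (Polynomial.bernoulli (2 * m))).eval t := by
            rw [bernoulliFun]; ring
      _ < _ := hlt
      _ = _ := by ring
  · simp only [mul_zero, Real.cos_zero]
    gcongr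
    exact Real.cos_le_one _
  · simp only [Nat.cast_one, one_pow, mul_zero, Real.cos_zero, mul_one, div_one, one_mul]
    refine lt_of_le_of_ne (Real.cos_le_one _) fun hcos => ?_
    rw [Real.cos_eq_one_iff] at hcos
    obtain ⟨n, hn⟩ := hcos
    have hnt : (n : ℝ) = t := by
      have := Real.pi_pos
      have h3 : 2 * Real.pi * ((n : ℝ) - t) = 0 := by linarith
      rcases mul_eq_zero.1 h3 with h4 | h4 <;> linarith
    have h5 : (0 : ℝ) < n := hnt ▸ ht.1
    have h6 : (n : ℝ) < 1 := hnt ▸ ht.2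
    norm_cast at h5 h6
    lia

/-! ### Euler–Maclaurin on a unit interval -/

/-- The integral `-(1 / i) ∫ B_i(t) / (x + t) ^ i` over the unit interval. -/
noncomputable def unitRemainder (i : ℕ) (x : ℝ) : ℝ :=
  -(∫ t in (0 : ℝ)..1, bernoulliFun i t / (x + t) ^ i) / i

theorem intervalIntegrable_div_add_pow (f : ℝ → ℝ) (hf : Continuous f) (i : ℕ) {x : ℝ} (hx : 0 < x) :
    IntervalIntegrable (fun t => f t / (x + t) ^ i) MeasureTheory.volume 0 1 := by
  refine ContinuousOn.intervalIntegrable (hf.continuousOn.div (by fun_prop) fun t ht => ?_)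
  rw [Set.uIcc_of_le zero_le_one] at ht
  have := ht.1
  positivity

theorem hasDerivAt_inv_add_pow (i : ℕ) {x t : ℝ} (h : x + t ≠ 0) :
    HasDerivAt (fun t : ℝ => ((x + t) ^ i)⁻¹) (-(i : ℝ) / (x + t) ^ (i + 1)) t := by
  have h1 := (((hasDerivAt_id t).const_add x).pow i).inv (pow_ne_zero i h)
  refine h1.congr_deriv ?_
  rcases i with _ | i
  · simp
  · simp only [id, Pi.pow_apply, Nat.add_sub_cancel, mul_one, Nat.cast_add, Nat.cast_one]
    field_simp
    ring

theorem integral_inv_add_pow {i : ℕ} (hi : i ≠ 0) {x : ℝ} (hx : 0 < x) :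
    ∫ t in (0 : ℝ)..1, 1 / (x + t) ^ (i + 1) = ((x ^ i)⁻¹ - ((x + 1) ^ i)⁻¹) / i := by
  have hi' : (i : ℝ) ≠ 0 := by exact_mod_cast hi
  rw [intervalIntegral.integral_eq_sub_of_hasDerivAt
    (f := fun t => -((x + t) ^ i)⁻¹ / i) (fun t ht => ?_)
    (intervalIntegrable_div_add_pow _ continuous_const _ hx)]
  · simp; ring
  · rw [Set.uIcc_of_le zero_le_one] at ht
    have := ht.1
    refine ((hasDerivAt_inv_add_pow i (by positivity)).neg.div_const _).congr_deriv ?_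
    field_simp

/-- Integration by parts: `B_{i+1}' = (i + 1) B_i`, and the two boundary terms share a coefficient
because `B_{i+1}(0) = B_{i+1}(1)` once `i + 1 ≥ 2`. -/
theorem unitRemainder_eq {i : ℕ} (hi : i ≠ 0) {x : ℝ} (hx : 0 < x) :
    unitRemainder i x = (bernoulli (i + 1) : ℝ) / (i * (i + 1)) * ((x ^ i)⁻¹ - ((x + 1) ^ i)⁻¹)
      + unitRemainder (i + 1) x := by
  have hi' : (i : ℝ) ≠ 0 := by exact_mod_cast hi
  have hi1 : (i : ℝ) + 1 ≠ 0 := by positivity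
  have key : ∫ t in (0 : ℝ)..1, (bernoulliFun i t / (x + t) ^ i
      - (i : ℝ) / (i + 1) * (bernoulliFun (i + 1) t / (x + t) ^ (i + 1)))
      = bernoulliFun (i + 1) 1 / (i + 1) * ((x + 1) ^ i)⁻¹
        - bernoulliFun (i + 1) 0 / (i + 1) * ((x + 0) ^ i)⁻¹ := by
    refine intervalIntegral.integral_eq_sub_of_hasDerivAt
      (f := fun t => bernoulliFun (i + 1) t / (i + 1) * ((x + t) ^ i)⁻¹) (fun t ht => ?_) ?_
    · rw [Set.uIcc_of_le zero_le_one] at ht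
      have := ht.1
      refine ((antideriv_bernoulliFun i t).mul
        (hasDerivAt_inv_add_pow i (by positivity))).congr_deriv ?_
      field_simp
      ring
    · exact (intervalIntegrable_div_add_pow _ (continuous_bernoulliFun i) _ hx).sub
        ((intervalIntegrable_div_add_pow _ (continuous_bernoulliFun (i + 1)) _ hx).const_mul _)
  rw [intervalIntegral.integral_sub
    (intervalIntegrable_div_add_pow _ (continuous_bernoulliFun i) _ hx)
    ((intervalIntegrable_div_add_pow _ (continuous_bernoulliFun (i + 1)) _ hx).const_mul _),
    intervalIntegral.integral_const_mul, bernoulliFun_endpoints_eq_of_ne_one (by lia),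
    bernoulliFun_eval_zero, add_zero] at key
  rw [sub_eq_iff_eq_add] at key
  unfold unitRemainder
  rw [key]
  push_cast
  field_simp
  ring

/-- One more integration by parts, with the boundary term written as an integral, turns the
remainder into `(1 / 2m) ∫ (B_{2m} - B_{2m}(t)) / (x + t) ^ (2m)`, whose integrand has constant sign
on `(0, 1)`. -/
theorem neg_one_pow_mul_unitRemainder_pos {m : ℕ} (hm : m ≠ 0) {x : ℝ} (hx : 0 < x) :
    0 < (-1) ^ (m + 1) * unitRemainder (2 * m - 1) x := by
  obtain ⟨i, rfl⟩ : ∃ i, m = i + 1 := ⟨m - 1, by lia⟩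
  have hi : 2 * (i + 1) - 1 = 2 * i + 1 := by lia
  have hpos : 0 < ∫ t in (0 : ℝ)..1, ((-1 : ℝ) ^ (i + 1 + 1) * (bernoulli (2 * (i + 1)) : ℝ)
      - (-1 : ℝ) ^ (i + 1 + 1) * bernoulliFun (2 * (i + 1)) t) / (x + t) ^ (2 * i + 1 + 1) := by
    refine intervalIntegral.intervalIntegral_pos_of_pos_on
      (intervalIntegrable_div_add_pow _ (by fun_prop) _ hx) (fun t ht => ?_) one_pos
    have := neg_one_pow_mul_bernoulliFun_lt hm ht
    have := ht.1
    exact div_pos (by linarith) (by positivity)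
  have heq : ∫ t in (0 : ℝ)..1, ((-1 : ℝ) ^ (i + 1 + 1) * (bernoulli (2 * (i + 1)) : ℝ)
      - (-1 : ℝ) ^ (i + 1 + 1) * bernoulliFun (2 * (i + 1)) t) / (x + t) ^ (2 * i + 1 + 1)
      = (-1 : ℝ) ^ (i + 1 + 1) * (bernoulli (2 * (i + 1)) : ℝ)
          * (∫ t in (0 : ℝ)..1, 1 / (x + t) ^ (2 * i + 1 + 1))
        - (-1 : ℝ) ^ (i + 1 + 1)
          * ∫ t in (0 : ℝ)..1, bernoulliFun (2 * (i + 1)) t / (x + t) ^ (2 * i + 1 + 1) := by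
    rw [← intervalIntegral.integral_const_mul, ← intervalIntegral.integral_const_mul,
      ← intervalIntegral.integral_sub]
    · refine intervalIntegral.integral_congr fun t _ => ?_
      ring
    · exact (intervalIntegrable_div_add_pow _ continuous_const _ hx).const_mul _
    · exact (intervalIntegrable_div_add_pow _ (continuous_bernoulliFun _) _ hx).const_mul _
  rw [heq, integral_inv_add_pow (by lia) hx] at hpos
  rw [hi, unitRemainder_eq (by lia) hx]
  unfold unitRemainder
  have h2 : 2 * i + 1 + 1 = 2 * (i + 1) := by ring
  rw [h2] at hpos ⊢
  have h3 : (0 : ℝ) < 2 * i + 2 := by positivity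
  have := div_pos hpos h3
  convert! this using 1
  push_cast
  have : (2 * (i : ℝ) + 1) ≠ 0 := by positivity
  field_simp
  ring

/-- The `j`-th term `B_{2j} / (2j (2j-1) x ^ (2j-1))` of Stirling's series. -/
noncomputable def stirlingTerm (j : ℕ) (x : ℝ) : ℝ :=
  (bernoulli (2 * j) : ℝ) / (2 * (j : ℝ) * (2 * (j : ℝ) - 1) * x ^ (2 * j - 1))

/-- Each step is two integrations by parts; the second has no boundary term since odd Bernoulli
numbers beyond `B_1` vanish. -/
theorem unitRemainder_one_sub_sum {m : ℕ} (hm : m ≠ 0) {x : ℝ} (hx : 0 < x) :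
    unitRemainder 1 x - ∑ j ∈ Finset.Ico 1 m, (stirlingTerm j x - stirlingTerm j (x + 1))
      = unitRemainder (2 * m - 1) x := by
  induction m, Nat.one_le_iff_ne_zero.2 hm using Nat.le_induction with
  | base => simp
  | succ m h1 ih =>
    obtain ⟨i, rfl⟩ : ∃ i, m = i + 1 := ⟨m - 1, by lia⟩
    rw [Finset.sum_Ico_succ_top h1, ← sub_sub, ih (by lia)]
    have e1 : 2 * (i + 1) - 1 = 2 * i + 1 := by lia
    have e2 : 2 * (i + 1 + 1) - 1 = 2 * i + 1 + 1 + 1 := by lia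
    have hodd : bernoulli (2 * i + 1 + 1 + 1) = 0 :=
      bernoulli_eq_zero_of_odd (by exact ⟨i + 1, by ring⟩) (by lia)
    rw [e1, e2, unitRemainder_eq (by lia) hx, unitRemainder_eq (i := 2 * i + 1 + 1) (by lia) hx,
      hodd]
    unfold stirlingTerm
    rw [e1, show 2 * i + 1 + 1 = 2 * (i + 1) by ring]
    push_cast
    have : (2 * (i : ℝ) + 1) ≠ 0 := by positivity
    have : (2 * ((i : ℝ) + 1) - 1) ≠ 0 := by ring_nf; positivity
    field_simp
    ring

theorem unitRemainder_one {x : ℝ} (hx : 0 < x) :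
    unitRemainder 1 x = (x + 1 / 2) * (Real.log (x + 1) - Real.log x) - 1 := by
  unfold unitRemainder
  rw [intervalIntegral.integral_eq_sub_of_hasDerivAt
    (f := fun t => t - (x + 1 / 2) * Real.log (x + t)) (fun t ht => ?_)
    (intervalIntegrable_div_add_pow _ (continuous_bernoulliFun 1) _ hx)]
  · simp; ring
  · rw [Set.uIcc_of_le zero_le_one] at ht
    have := ht.1
    have hne : x + t ≠ 0 := by positivity
    refine ((hasDerivAt_id t).sub ((((hasDerivAt_id t).const_add x).log hne).const_mul _)).congr_deriv ?_
    rw [bernoulliFun_one]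
    simp only [id]
    field_simp
    ring

/-! ### Stirling's series and the sign of its remainders -/

/-- The remainder in Stirling's formula for `log n!`. -/
noncomputable def stirlingRemainder (n : ℕ) : ℝ :=
  Real.log (n ! : ℝ) - (n * Real.log n - n + Real.log (2 * Real.pi * n) / 2)

theorem tendsto_stirlingRemainder : Tendsto stirlingRemainder atTop (𝓝 0) := by
  have h := ((Real.continuousAt_log (by positivity : √Real.pi ≠ 0)).tendsto.comp
    Stirling.tendsto_stirlingSeq_sqrt_pi).sub_const (Real.log √Real.pi)
  rw [sub_self] at h
  refine h.congr' ?_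
  filter_upwards [eventually_ne_atTop 0] with n hn
  have hn' : (n : ℝ) ≠ 0 := by exact_mod_cast hn
  simp only [Function.comp, Stirling.log_stirlingSeq_formula, stirlingRemainder]
  rw [Real.log_sqrt Real.pi_pos.le, Real.log_div hn' (Real.exp_pos 1).ne', Real.log_exp,
    Real.log_mul (by norm_num) hn', Real.log_mul (by positivity) hn',
    Real.log_mul (by norm_num) (by positivity)]
  ring

theorem stirlingRemainder_sub_succ {n : ℕ} (hn : n ≠ 0) :
    stirlingRemainder n - stirlingRemainder (n + 1) = unitRemainder 1 n := by
  have hn' : (0 : ℝ) < n := by positivity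
  rw [unitRemainder_one hn']
  unfold stirlingRemainder
  rw [Nat.factorial_succ]
  push_cast
  rw [Real.log_mul (x := (n : ℝ) + 1) (by positivity) (by positivity),
    Real.log_mul (y := (n : ℝ)) (by positivity) (by positivity),
    Real.log_mul (y := (n : ℝ) + 1) (by positivity) (by positivity)]
  ring

/-- The remainder after the terms `1 ≤ j < m` of Stirling's series. -/
noncomputable def stirlingTail (m n : ℕ) : ℝ :=
  stirlingRemainder n - ∑ j ∈ Finset.Ico 1 m, stirlingTerm j n

theorem tendsto_stirlingTerm {j : ℕ} (hj : j ≠ 0) :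
    Tendsto (fun n : ℕ => stirlingTerm j n) atTop (𝓝 0) := by
  have h1 : Tendsto (fun n : ℕ => ((n : ℝ) ^ (2 * j - 1))⁻¹) atTop (𝓝 0) :=
    ((tendsto_pow_atTop (by lia)).comp tendsto_natCast_atTop_atTop).inv_tendsto_atTop
  have h2 := h1.const_mul ((bernoulli (2 * j) : ℝ) / (2 * (j : ℝ) * (2 * (j : ℝ) - 1)))
  rw [mul_zero] at h2
  refine h2.congr fun n => ?_
  rw [stirlingTerm, ← div_eq_mul_inv, div_div]

theorem tendsto_stirlingTail (m : ℕ) : Tendsto (stirlingTail m) atTop (𝓝 0) := by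
  have h := tendsto_stirlingRemainder.sub (tendsto_finsetSum (Finset.Ico 1 m)
    (f := fun j (n : ℕ) => stirlingTerm j n) (a := fun _ => 0) fun j hj =>
      tendsto_stirlingTerm (by have := (Finset.mem_Ico.1 hj).1; lia))
  rw [Finset.sum_const_zero, sub_zero] at h
  exact h

/-- With the sign attached, the remainder strictly decreases in `n`, its decrements being the
positive Euler–Maclaurin integrals, and it tends to `0`. -/
theorem neg_one_pow_mul_stirlingTail_pos {m n : ℕ} (hm : m ≠ 0) (hn : n ≠ 0) :
    0 < (-1) ^ (m + 1) * stirlingTail m n := by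
  set g : ℕ → ℝ := fun i => (-1) ^ (m + 1) * stirlingTail m (n + i) with hg
  have hlt : StrictAnti g := strictAnti_nat_of_succ_lt fun i => by
    have hni : (0 : ℝ) < ((n + i : ℕ) : ℝ) := by positivity
    have h1 := neg_one_pow_mul_unitRemainder_pos hm hni
    rw [← unitRemainder_one_sub_sum hm hni, ← stirlingRemainder_sub_succ (by lia),
      Finset.sum_sub_distrib] at h1
    simp only [hg, stirlingTail, ← add_assoc]
    push_cast at h1 ⊢
    linarith
  have ht : Tendsto g atTop (𝓝 0) := by
    have := ((tendsto_stirlingTail m).comp (tendsto_add_atTop_nat n)).const_mul ((-1 : ℝ) ^ (m + 1))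
    rw [mul_zero] at this
    refine this.congr fun i => ?_
    simp [hg, add_comm]
  have h0 : 0 ≤ g 1 := hlt.antitone.le_of_tendsto ht 1
  exact h0.trans_lt (hlt zero_lt_one)

theorem stirlingTail_succ {m n : ℕ} (hm : m ≠ 0) :
    stirlingTail m n = stirlingTerm m n + stirlingTail (m + 1) n := by
  unfold stirlingTail
  rw [Finset.sum_Ico_succ_top (by lia)]
  ring

/-- Consecutive remainders have opposite signs and differ by the term, so the term exceeds the
remainder in size. -/
theorem abs_stirlingTail_le {m n : ℕ} (hm : m ≠ 0) (hn : n ≠ 0) :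
    |stirlingTail m n| ≤ |stirlingTerm m n| := by
  have h1 := neg_one_pow_mul_stirlingTail_pos hm hn
  have h2 := neg_one_pow_mul_stirlingTail_pos (m := m + 1) (by lia) hn
  have h3 : |stirlingTail m n| = (-1) ^ (m + 1) * stirlingTail m n := by
    rw [← abs_of_pos h1, abs_mul, abs_pow]; simp
  have h4 : (-1 : ℝ) ^ (m + 1) * stirlingTerm m n ≤ |stirlingTerm m n| := by
    refine (le_abs_self _).trans ?_
    rw [abs_mul, abs_pow]; simp
  rw [stirlingTail_succ hm] at h3 ⊢
  rw [h3]
  rw [pow_succ] at h2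
  linarith

/-! ### Enveloping divergent series from alternating remainders -/

/-- Since `t m` and `t (m + 1)` have opposite signs, `a m` has the sign of `t m` and is larger in
size, which makes `θ = t m / a m` admissible. -/
theorem isEnvelopingDivergentSum_of_alternating {a t : ℕ → ℝ}
    (hdiv : ¬ Tendsto a atTop (𝓝 0)) (ht : ∀ m, 2 ≤ m → t m = a m + t (m + 1))
    (hpos : ∀ m, 2 ≤ m → 0 < (-1) ^ (m + 1) * t m) :
    IsEnvelopingDivergentSum 2 a (t 2) := by
  refine ⟨fun ⟨L, hL⟩ => hdiv ?_, fun m hm => ?_⟩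
  · have h := (hL.comp (tendsto_add_atTop_nat 1)).sub hL
    rw [sub_self] at h
    refine h.congr' ?_
    filter_upwards [eventually_ge_atTop 2] with m hm
    simp [Function.comp, Finset.sum_Ico_succ_top hm]
  · have hsum : t 2 = (∑ j ∈ Finset.Ico 2 m, a j) + t m := by
      induction m, hm using Nat.le_induction with
      | base => simp
      | succ m hm ih => rw [ih, Finset.sum_Ico_succ_top hm, ht m hm]; ring
    have h1 := hpos m hm
    have h2 := hpos (m + 1) (by lia)
    have h3 := ht m hm
    rw [pow_succ] at h2
    have h4 : 0 < (-1 : ℝ) ^ (m + 1) * a m := by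
      have : (-1 : ℝ) ^ (m + 1) * t m = (-1) ^ (m + 1) * a m + (-1) ^ (m + 1) * t (m + 1) := by
        rw [h3]; ring
      linarith
    have ha : a m ≠ 0 := fun h => by simp [h] at h4
    have hq : t m / a m = ((-1) ^ (m + 1) * t m) / ((-1) ^ (m + 1) * a m) := by
      rw [mul_div_mul_left]; positivity
    refine ⟨t m / a m, ?_, ?_, ?_⟩
    · rw [hq]; exact div_pos h1 h4
    · rw [hq, div_lt_one h4, h3]; linarith
    · rw [hsum, div_mul_cancel₀ _ ha]

theorem not_tendsto_bernoulli_mul {Z : ℕ → ℝ} {N : ℝ} (hN : 0 < N)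
    (hZ : ∀ j, 2 ≤ j → (N ^ (2 * j - 1))⁻¹ ≤ Z j) :
    ¬ Tendsto (fun j : ℕ => (bernoulli (2 * j) : ℝ) * Z j / (2 * (j : ℝ) * (2 * (j : ℝ) - 1)))
      atTop (𝓝 0) := by
  intro h
  set c := 2 * Real.pi * N with hc
  have hc0 : 0 < c := by positivity
  -- The lower bound for the term of index `p + 1` is `2N (2p)! / c ^ (2p + 2)`. The null factor `c
  -- ^ (2p) / (2p)! * (c ^ 2 / (2N))` is its exact inverse, so the product stays at least `1`.
  have h1 := (((FloorSemiring.tendsto_pow_div_factorial_atTop c).comp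
    (tendsto_id.const_mul_atTop' (two_pos : 0 < 2))).mul_const (c ^ 2 / (2 * N))).mul
    ((h.comp (tendsto_add_atTop_nat 1)).abs)
  rw [abs_zero, mul_zero] at h1
  obtain ⟨p, hp1, hp2⟩ := ((h1.eventually (gt_mem_nhds one_pos)).and (eventually_ge_atTop 1)).exists
  refine hp1.not_ge ?_
  have hb := bernoulli_two_mul_lower_bound (m := p + 1) (by lia)
  have hz := hZ (p + 1) (by lia)
  have hz0 : 0 < Z (p + 1) := lt_of_lt_of_le (by positivity) hz
  have hden : (0 : ℝ) < 2 * ((p + 1 : ℕ) : ℝ) * (2 * ((p + 1 : ℕ) : ℝ) - 1) := by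
    push_cast; have : (0 : ℝ) ≤ p := by positivity
    exact mul_pos (by positivity) (by linarith)
  have habs : (2 * ((2 * (p + 1))! : ℝ) / (2 * Real.pi) ^ (2 * (p + 1)))
      * (N ^ (2 * (p + 1) - 1))⁻¹ / (2 * ((p + 1 : ℕ) : ℝ) * (2 * ((p + 1 : ℕ) : ℝ) - 1)) ≤
      |(bernoulli (2 * (p + 1)) : ℝ) * Z (p + 1)
        / (2 * ((p + 1 : ℕ) : ℝ) * (2 * ((p + 1 : ℕ) : ℝ) - 1))| := by
    rw [abs_div, abs_mul, abs_of_pos hden, abs_of_pos hz0]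
    have : (-1) ^ (p + 1 + 1) * (bernoulli (2 * (p + 1)) : ℝ) ≤ |(bernoulli (2 * (p + 1)) : ℝ)| := by
      refine (le_abs_self _).trans ?_
      rw [abs_mul, abs_pow]; simp
    gcongr
    exact hb.trans this
  simp only [Function.comp, id]
  refine le_trans (le_of_eq ?_) (mul_le_mul_of_nonneg_left habs (by positivity))
  have e1 : 2 * (p + 1) - 1 = 2 * p + 1 := by lia
  have hd2 : (2 * ((p : ℝ) + 1) - 1) = 2 * p + 1 := by ring
  rw [e1, show 2 * (p + 1) = 2 * p + 1 + 1 by ring, Nat.factorial_succ, Nat.factorial_succ, hc]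
  push_cast
  rw [hd2]
  have hpi := Real.pi_pos.ne'
  field_simp
  ring

/-! ### Summing Stirling's series over a family of integers -/

section Family

variable {ι : Type*} {x : ι → ℕ} {Z : ℕ → ℝ}

theorem hasSum_stirlingTerm {j : ℕ}
    (hZ : HasSum (fun i => (((x i : ℕ) : ℝ) ^ (2 * j - 1))⁻¹) (Z j)) :
    HasSum (fun i => stirlingTerm j (x i))
      ((bernoulli (2 * j) : ℝ) * Z j / (2 * (j : ℝ) * (2 * (j : ℝ) - 1))) := by
  have h := hZ.mul_left ((bernoulli (2 * j) : ℝ) / (2 * (j : ℝ) * (2 * (j : ℝ) - 1)))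
  convert! h using 1
  · funext i
    rw [stirlingTerm, ← div_eq_mul_inv, div_div]
  · ring

theorem summable_stirlingTail (hx : ∀ i, x i ≠ 0) {j : ℕ} (hj : j ≠ 0)
    (hZ : HasSum (fun i => (((x i : ℕ) : ℝ) ^ (2 * j - 1))⁻¹) (Z j)) :
    Summable fun i => stirlingTail j (x i) :=
  (hasSum_stirlingTerm hZ).summable.abs.of_norm_bounded fun i =>
    abs_stirlingTail_le hj (hx i)

/-- The recursion and the signs of the remainders pass to the sums. For divergence, `Z j` is at
least the contribution of a single member `x i₀`, which decays only geometrically. -/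
theorem isEnvelopingDivergentSum_tsum_stirlingTail [Nonempty ι] (hx : ∀ i, x i ≠ 0)
    (hZ : ∀ j, 2 ≤ j → HasSum (fun i => (((x i : ℕ) : ℝ) ^ (2 * j - 1))⁻¹) (Z j)) :
    IsEnvelopingDivergentSum 2
      (fun j : ℕ => (bernoulli (2 * j) : ℝ) * Z j / (2 * (j : ℝ) * (2 * (j : ℝ) - 1)))
      (∑' i, stirlingTail 2 (x i)) := by
  obtain ⟨i₀⟩ := ‹Nonempty ι›
  have hs : ∀ m, 2 ≤ m → Summable fun i => stirlingTail m (x i) := fun m hm =>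
    summable_stirlingTail hx (by lia) (hZ m hm)
  refine isEnvelopingDivergentSum_of_alternating (t := fun m => ∑' i, stirlingTail m (x i))
    (not_tendsto_bernoulli_mul (N := x i₀) (by have := hx i₀; positivity) fun j hj =>
      le_hasSum (hZ j hj) i₀ fun i _ => by positivity) (fun m hm => ?_) (fun m hm => ?_)
  · rw [← (hasSum_stirlingTerm (hZ m hm)).tsum_eq,
      ← (hasSum_stirlingTerm (hZ m hm)).summable.tsum_add (hs (m + 1) (by lia))]
    exact tsum_congr fun i => stirlingTail_succ (by lia)
  · simp only [← tsum_mul_left]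
    exact ((hs m hm).mul_left _).tsum_pos
      (fun i => (neg_one_pow_mul_stirlingTail_pos (by lia) (hx i)).le) i₀
      (neg_one_pow_mul_stirlingTail_pos (by lia) (hx i₀))

end Family

theorem hasSum_zetaOdd {j : ℕ} (hj : 2 ≤ j) :
    HasSum (fun ν : ℕ => ((((ν + 1 : ℕ) : ℝ)) ^ (2 * j - 1))⁻¹) (zetaOdd j) := by
  have hs : Summable fun ν : ℕ => ((((ν + 1 : ℕ) : ℝ)) ^ (2 * j - 1))⁻¹ :=
    (summable_nat_add_iff 1).2 (Real.summable_nat_pow_inv.2 (by lia : 1 < 2 * j - 1))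
  have h2 : (2 * (j : ℂ) - 1) = ((2 * j - 1 : ℕ) : ℂ) := by
    rw [Nat.cast_sub (by lia)]; push_cast; ring
  have hz : zetaOdd j = ∑' ν : ℕ, ((((ν + 1 : ℕ) : ℝ)) ^ (2 * j - 1))⁻¹ := by
    rw [zetaOdd, zeta_eq_tsum_one_div_nat_add_one_cpow, h2]
    · simp only [Complex.cpow_natCast]
      rw [← Complex.ofReal_re (∑' ν : ℕ, ((((ν + 1 : ℕ) : ℝ)) ^ (2 * j - 1))⁻¹), Complex.ofReal_tsum]
      congr 1
      refine tsum_congr fun ν => ?_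
      push_cast
      rw [one_div]
    · rw [h2, Complex.natCast_re]
      exact_mod_cast (by lia : 1 < 2 * j - 1)
  rw [hz]
  exact hs.hasSum

theorem hasSum_mul_add_one {j : ℕ} (hj : 2 ≤ j) (k : ℕ) :
    HasSum (fun ν : ℕ => (((k * (ν + 1) : ℕ) : ℝ) ^ (2 * j - 1))⁻¹)
      (zetaOdd j / (k : ℝ) ^ (2 * j - 1)) := by
  have h := (hasSum_zetaOdd hj).div_const ((k : ℝ) ^ (2 * j - 1))
  refine h.congr_fun fun ν => ?_
  push_cast
  rw [mul_pow, mul_inv]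
  ring

theorem hasSum_add_one_mul_add_one {j : ℕ} (hj : 2 ≤ j) :
    HasSum (fun p : ℕ × ℕ => ((((p.1 + 1) * (p.2 + 1) : ℕ) : ℝ) ^ (2 * j - 1))⁻¹)
      (zetaOdd j ^ 2) := by
  have h := hasSum_zetaOdd hj
  have h2 := h.mul h (h.summable.mul_of_nonneg h.summable (fun _ => by positivity)
    (fun _ => by positivity))
  rw [← sq] at h2
  refine h2.congr_fun fun p => ?_
  push_cast
  rw [mul_pow, mul_inv]

/-! ### Euler–Maclaurin for `ζ` near `-1` and the Glaisher–Kinkelin constant -/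

/-- The Euler–Maclaurin remainder of `x ↦ x ^ (-s)` on `[a, a + 1]`, after the second Bernoulli
term. -/
noncomputable def cpowRemainder (a : ℝ) (s : ℂ) : ℂ :=
  ((a : ℂ) ^ (-s) + ((a + 1 : ℝ) : ℂ) ^ (-s)) / 2
    - (((a + 1 : ℝ) : ℂ) ^ (1 - s) - (a : ℂ) ^ (1 - s)) / (1 - s)
    + s / 12 * (((a + 1 : ℝ) : ℂ) ^ (-s - 1) - (a : ℂ) ^ (-s - 1))

theorem hasDerivAt_add_ofReal_cpow {a t : ℝ} (h : 0 < a + t) (w : ℂ) :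
    HasDerivAt (fun t : ℝ => ((a + t : ℝ) : ℂ) ^ w) (w * ((a + t : ℝ) : ℂ) ^ (w - 1)) t := by
  have h1 : HasDerivAt (fun z : ℂ => z ^ w) (w * ((a + t : ℝ) : ℂ) ^ (w - 1)) ((a + t : ℝ) : ℂ) := by
    simpa using (hasDerivAt_id ((a + t : ℝ) : ℂ)).cpow_const (c := w)
      (Complex.ofReal_mem_slitPlane.2 h)
  exact h1.comp_ofReal.comp_const_add a t

theorem norm_cpowRemainder_le {a : ℝ} (ha : 1 ≤ a) {s : ℂ} (hs : s ≠ 1) (h10 : ‖s‖ ≤ 10)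
    (hre : -(3 / 2) ≤ s.re) : ‖cpowRemainder a s‖ ≤ 17160 * a ^ (-(5 / 2) : ℝ) := by
  have hs' : 1 - s ≠ 0 := sub_ne_zero.2 hs.symm
  set c : ℂ → ℝ → ℂ := fun w t => ((a + t : ℝ) : ℂ) ^ w with hc
  -- With `q = t² - 2t³ + t⁴ = B_4(t) - B_4`, the coefficients are `q'''/24`, `q''/24`, `q'/24`,
  -- `q/24`, so the derivative telescopes to the fourth-order term. As `q` and `q'` vanish at both
  -- ends and `q'' = 2` there, `Ψ 1 - Ψ 0` is the remainder. The constant `17160` is `10 * 11 * 12 *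
  -- 13`.
  set Ψ : ℝ → ℂ := fun t =>
    ((t : ℂ) - 1 / 2) * c (-s) t + (2 - 12 * (t : ℂ) + 12 * (t : ℂ) ^ 2) / 24 * (s * c (-s - 1) t)
      + (2 * (t : ℂ) - 6 * (t : ℂ) ^ 2 + 4 * (t : ℂ) ^ 3) / 24 * (s * (s + 1) * c (-s - 1 - 1) t)
      + ((t : ℂ) ^ 2 - 2 * (t : ℂ) ^ 3 + (t : ℂ) ^ 4) / 24
        * (s * (s + 1) * (s + 2) * c (-s - 1 - 1 - 1) t)
      - c (1 - s) t / (1 - s) with hΨ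
  have hder : ∀ t ∈ Set.Icc (0 : ℝ) 1, HasDerivWithinAt Ψ
      (-(((t : ℂ) ^ 2 - 2 * (t : ℂ) ^ 3 + (t : ℂ) ^ 4) / 24
        * (s * (s + 1) * (s + 2) * (s + 3) * c (-s - 1 - 1 - 1 - 1) t))) (Set.Icc 0 1) t := by
    intro t ht
    refine HasDerivAt.hasDerivWithinAt ?_
    have hpos : 0 < a + t := by linarith [ht.1]
    have hid : HasDerivAt (fun t : ℝ => (t : ℂ)) 1 t := by
      simpa using (hasDerivAt_id t).ofReal_comp
    have hd := fun w => hasDerivAt_add_ofReal_cpow hpos w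
    have h0 := (hid.sub_const (1 / 2)).mul (hd (-s))
    have h1 := ((((hid.const_mul 12).const_sub 2).add ((hid.pow 2).const_mul 12)).div_const 24).mul
      ((hd (-s - 1)).const_mul s)
    have h2 := ((((hid.const_mul 2).sub ((hid.pow 2).const_mul 6)).add
      ((hid.pow 3).const_mul 4)).div_const 24).mul ((hd (-s - 1 - 1)).const_mul (s * (s + 1)))
    have h3 := ((((hid.pow 2).sub ((hid.pow 3).const_mul 2)).add (hid.pow 4)).div_const 24).mul
      ((hd (-s - 1 - 1 - 1)).const_mul (s * (s + 1) * (s + 2)))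
    have h4 := (hd (1 - s)).div_const (1 - s)
    refine ((((h0.add h1).add h2).add h3).sub h4).congr_deriv ?_
    rw [show (1 - s - 1) = -s by ring, mul_div_assoc, mul_div_cancel₀]
    simp only [hc, Pi.add_apply, Pi.sub_apply, Pi.pow_apply, Nat.cast_ofNat]
    push_cast
    ring
    exact hs'
  have hbound : ∀ t ∈ Set.Ico (0 : ℝ) 1, ‖(-(((t : ℂ) ^ 2 - 2 * (t : ℂ) ^ 3 + (t : ℂ) ^ 4) / 24
        * (s * (s + 1) * (s + 2) * (s + 3) * c (-s - 1 - 1 - 1 - 1) t)))‖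
        ≤ 17160 * a ^ (-(5 / 2) : ℝ) := by
    intro t ht
    have hpos : 0 < a + t := by linarith [ht.1]
    have hq : ‖((t : ℂ) ^ 2 - 2 * (t : ℂ) ^ 3 + (t : ℂ) ^ 4) / 24‖ ≤ 1 := by
      rw [show ((t : ℂ) ^ 2 - 2 * (t : ℂ) ^ 3 + (t : ℂ) ^ 4) / 24
        = (((t * (1 - t)) ^ 2 / 24 : ℝ) : ℂ) by push_cast; ring, Complex.norm_real,
        Real.norm_of_nonneg (by positivity)]
      have h1 : t * (1 - t) ≤ 1 := by nlinarith [ht.1, ht.2]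
      have h0 : 0 ≤ t * (1 - t) := mul_nonneg ht.1 (by linarith [ht.2])
      have := pow_le_one₀ (n := 2) h0 h1
      linarith
    have hcb : ‖c (-s - 1 - 1 - 1 - 1) t‖ ≤ a ^ (-(5 / 2) : ℝ) := by
      simp only [hc]
      rw [Complex.norm_cpow_eq_rpow_re_of_pos hpos]
      calc _ ≤ (a + t) ^ (-(5 / 2) : ℝ) := by
            refine Real.rpow_le_rpow_of_exponent_le (by linarith [ht.1]) ?_
            simp only [Complex.sub_re, Complex.neg_re, Complex.one_re]
            linarith
        _ ≤ _ := Real.rpow_le_rpow_of_nonpos (by linarith) (by linarith [ht.1]) (by norm_num)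
    have e1 : ‖s + 1‖ ≤ 11 := (norm_add_le _ _).trans (by simp; linarith)
    have e2 : ‖s + 2‖ ≤ 12 := (norm_add_le _ _).trans (by simp; linarith)
    have e3 : ‖s + 3‖ ≤ 13 := (norm_add_le _ _).trans (by simp; linarith)
    rw [norm_neg, norm_mul, norm_mul, norm_mul, norm_mul, norm_mul]
    calc _ ≤ 1 * (10 * 11 * 12 * 13 * a ^ (-(5 / 2) : ℝ)) := by gcongr
      _ = _ := by ring
  have hmain := norm_image_sub_le_of_norm_deriv_le_segment_01' hder hbound
  convert! hmain using 2
  simp only [hΨ, hc, cpowRemainder]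
  rw [show -s - 1 = -s + -1 by ring]
  push_cast
  simp only [add_zero]
  ring

theorem differentiableAt_cpowRemainder {a : ℝ} (ha : 0 < a) {s : ℂ} (hs : s ≠ 1) :
    DifferentiableAt ℂ (cpowRemainder a) s := by
  have ha' : (a : ℂ) ≠ 0 := by exact_mod_cast ha.ne'
  have hb' : ((a + 1 : ℝ) : ℂ) ≠ 0 := by exact_mod_cast (by positivity : a + 1 ≠ 0)
  have hs' : 1 - s ≠ 0 := sub_ne_zero.2 hs.symm
  unfold cpowRemainder
  have hd : ∀ (b : ℂ), b ≠ 0 → ∀ f : ℂ → ℂ, DifferentiableAt ℂ f s →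
      DifferentiableAt ℂ (fun s => b ^ f s) s := fun b hb f hf => hf.const_cpow (Or.inl hb)
  refine (((((hd _ ha' _ ?_).add (hd _ hb' _ ?_)).div_const _).sub
    (((hd _ hb' _ ?_).sub (hd _ ha' _ ?_)).div ?_ hs'))).add
    (DifferentiableAt.mul ?_ ((hd _ hb' _ ?_).sub (hd _ ha' _ ?_))) <;> fun_prop

theorem hasDerivAt_cpowRemainder_neg_one {a : ℝ} (ha : 0 < a) :
    HasDerivAt (cpowRemainder a)
      (((-(a * Real.log a + (a + 1) * Real.log (a + 1)) / 2
        + ((a + 1) ^ 2 * Real.log (a + 1) - a ^ 2 * Real.log a) / 2 - ((a + 1) ^ 2 - a ^ 2) / 4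
        + (Real.log (a + 1) - Real.log a) / 12 : ℝ)) : ℂ) (-1) := by
  have hd : ∀ (b : ℝ), 0 < b → ∀ f : ℂ → ℂ, HasDerivAt f (-1) (-1) →
      HasDerivAt (fun s => (b : ℂ) ^ f s) ((b : ℂ) ^ f (-1) * (Real.log b : ℂ) * -1) (-1) :=
    fun b hb f hf => by
      have := hf.const_cpow (c := (b : ℂ)) (Or.inl (by exact_mod_cast hb.ne'))
      rwa [← Complex.ofReal_log hb.le] at this
  have hb : 0 < a + 1 := by positivity
  have h1 : HasDerivAt (fun s : ℂ => -s) (-1) (-1) := (hasDerivAt_id _).neg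
  have h2 : HasDerivAt (fun s : ℂ => 1 - s) (-1) (-1) := (hasDerivAt_id _).const_sub 1
  have h3 : HasDerivAt (fun s : ℂ => -s - 1) (-1) (-1) := h1.sub_const 1
  have h4 : HasDerivAt (fun s : ℂ => s / 12) (1 / 12) (-1) := (hasDerivAt_id _).div_const 12
  refine (((((hd _ ha _ h1).add (hd _ hb _ h1)).div_const 2).sub
    (((hd _ hb _ h2).sub (hd _ ha _ h2)).div h2 (by norm_num)))).add
    (h4.mul ((hd _ hb _ h3).sub (hd _ ha _ h3))) |>.congr_deriv ?_
  have e1 : (-(-1 : ℂ)) = 1 := by norm_num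
  have e2 : (1 - (-1 : ℂ)) = ((2 : ℕ) : ℂ) := by norm_num
  simp only [e1, e2, sub_self, Complex.cpow_one, Complex.cpow_natCast, Complex.cpow_zero, Pi.sub_apply]
  push_cast
  ring

theorem tendsto_add_one_ofReal_cpow {w : ℂ} (hw : w.re < 0) :
    Tendsto (fun n : ℕ => (((n : ℝ) + 1 : ℝ) : ℂ) ^ w) atTop (𝓝 0) := by
  rw [tendsto_zero_iff_norm_tendsto_zero]
  have h := ((tendsto_rpow_neg_atTop (neg_pos.2 hw)).comp tendsto_natCast_atTop_atTop).comp
    (tendsto_add_atTop_nat 1)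
  refine h.congr fun n => ?_
  rw [Complex.norm_cpow_eq_rpow_re_of_pos (by positivity)]
  simp

/-- The integral and Bernoulli parts telescope; for `Re s > 1` their values at the upper end vanish
in the limit, leaving those at `1`. -/
theorem tendsto_sum_cpowRemainder {s : ℂ} (hs : 1 < s.re) :
    Tendsto (fun N : ℕ => ∑ i ∈ Finset.range N, cpowRemainder ((i : ℝ) + 1) s) atTop
      (𝓝 (riemannZeta s - (1 / (s - 1) + 1 / 2 + s / 12))) := by
  have hs1 : s ≠ 1 := by rintro rfl; simp at hs
  have hs' : 1 - s ≠ 0 := sub_ne_zero.2 hs1.symm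
  have hs'' : s - 1 ≠ 0 := sub_ne_zero.2 hs1
  have hsum : Summable fun n : ℕ => 1 / (n + 1 : ℂ) ^ s := by
    have := (summable_nat_add_iff 1).2 (Complex.summable_one_div_nat_cpow.2 hs)
    simpa using this
  have hz := hsum.hasSum.tendsto_sum_nat
  rw [← zeta_eq_tsum_one_div_nat_add_one_cpow hs] at hz
  have h1 := tendsto_add_one_ofReal_cpow (w := -s) (by simp; linarith)
  have h2 := tendsto_add_one_ofReal_cpow (w := 1 - s) (by simp; linarith)
  have h3 := tendsto_add_one_ofReal_cpow (w := -s - 1) (by simp; linarith)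
  have key : ∀ N : ℕ, ∑ i ∈ Finset.range N, cpowRemainder ((i : ℝ) + 1) s
      = (∑ i ∈ Finset.range N, 1 / (i + 1 : ℂ) ^ s) + ((((N : ℝ) + 1 : ℝ) : ℂ) ^ (-s) - 1) / 2
        - ((((N : ℝ) + 1 : ℝ) : ℂ) ^ (1 - s) - 1) / (1 - s)
        + s / 12 * ((((N : ℝ) + 1 : ℝ) : ℂ) ^ (-s - 1) - 1) := by
    intro N
    induction N with
    | zero => simp
    | succ N ih =>
      rw [Finset.sum_range_succ, ih, Finset.sum_range_succ, cpowRemainder, one_div, ← Complex.cpow_neg]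
      push_cast
      ring
  have hlim := ((hz.add ((h1.sub_const 1).div_const 2)).sub ((h2.sub_const 1).div_const (1 - s))).add
    ((h3.sub_const 1).const_mul (s / 12))
  refine (hlim.congr fun N => (key N).symm).trans_eq ?_
  congr 1
  field_simp
  ring

/-- A convex region containing `-1` and points of real part greater than `1`, but not `1`. -/
def tiltedRegion : Set ℂ :=
  Metric.ball 0 10 ∩ {s | -(3 / 2) < s.re} ∩ {s | s.re - s.im < 1}

theorem isOpen_tiltedRegion : IsOpen tiltedRegion :=
  (Metric.isOpen_ball.inter (isOpen_lt continuous_const Complex.continuous_re)).inter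
    (isOpen_lt (by fun_prop) continuous_const)

theorem convex_tiltedRegion : Convex ℝ tiltedRegion := by
  refine ((convex_ball 0 10).inter (convex_halfSpace_re_gt _)).inter ?_
  exact convex_halfSpace_lt (Complex.reLm - Complex.imLm).isLinear 1

theorem ne_one_of_mem_tiltedRegion {s : ℂ} (hs : s ∈ tiltedRegion) : s ≠ 1 := by
  rintro rfl
  have := hs.2
  simp at this

theorem neg_one_mem_tiltedRegion : (-1 : ℂ) ∈ tiltedRegion := by
  simp only [tiltedRegion, Set.mem_inter_iff, mem_ball_zero_iff, Set.mem_ofPred_eq, norm_neg, norm_one,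
    Complex.neg_re, Complex.one_re, Complex.neg_im, Complex.one_im]
  norm_num

theorem norm_cpowRemainder_le_of_mem (i : ℕ) {s : ℂ} (hs : s ∈ tiltedRegion) :
    ‖cpowRemainder ((i : ℝ) + 1) s‖ ≤ 17160 * ((i : ℝ) + 1) ^ (-(5 / 2) : ℝ) :=
  norm_cpowRemainder_le (by simp) (ne_one_of_mem_tiltedRegion hs) (mem_ball_zero_iff.1 hs.1.1).le
    hs.1.2.le

theorem summable_add_one_rpow :
    Summable fun i : ℕ => 17160 * ((i : ℝ) + 1) ^ (-(5 / 2) : ℝ) := by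
  have h := (summable_nat_add_iff 1).2
    (Real.summable_nat_rpow (p := -(5 / 2)).2 (by norm_num))
  simpa using h.mul_left 17160

theorem differentiableOn_cpowRemainder (i : ℕ) :
    DifferentiableOn ℂ (cpowRemainder ((i : ℝ) + 1)) tiltedRegion := fun _ hs =>
  (differentiableAt_cpowRemainder (by positivity)
    (ne_one_of_mem_tiltedRegion hs)).differentiableWithinAt

/-- Analytic continuation: both sides are holomorphic on a convex region avoiding the pole and agree
near `2 + 3i`, where the Dirichlet series converges. -/
theorem riemannZeta_eq_on_tiltedRegion : Set.EqOn riemannZeta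
    (fun s => 1 / (s - 1) + 1 / 2 + s / 12 + ∑' i : ℕ, cpowRemainder ((i : ℝ) + 1) s)
    tiltedRegion := by
  have hd1 : DifferentiableOn ℂ riemannZeta tiltedRegion := fun s hs =>
    (differentiableAt_riemannZeta (ne_one_of_mem_tiltedRegion hs)).differentiableWithinAt
  have hd2 : DifferentiableOn ℂ (fun s => 1 / (s - 1) + 1 / 2 + s / 12
      + ∑' i : ℕ, cpowRemainder ((i : ℝ) + 1) s) tiltedRegion := by
    refine DifferentiableOn.add (fun s hs => ?_) (Complex.differentiableOn_tsum_of_summable_norm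
      summable_add_one_rpow differentiableOn_cpowRemainder isOpen_tiltedRegion
      fun i s hs => norm_cpowRemainder_le_of_mem i hs)
    have := sub_ne_zero.2 (ne_one_of_mem_tiltedRegion hs)
    exact DifferentiableAt.differentiableWithinAt (by fun_prop (disch := assumption))
  have hz : (2 + 3 * Complex.I : ℂ) ∈ tiltedRegion := by
    refine ⟨⟨?_, ?_⟩, ?_⟩
    · rw [mem_ball_zero_iff]
      refine (norm_add_le _ _).trans_lt ?_
      simp; norm_num
    · simp; norm_num
    · simp; norm_num
  refine (hd1.analyticOnNhd isOpen_tiltedRegion).eqOn_of_preconnected_of_eventuallyEq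
    (hd2.analyticOnNhd isOpen_tiltedRegion) convex_tiltedRegion.isPreconnected hz ?_
  have h1 : {s : ℂ | 1 < s.re} ∈ 𝓝 (2 + 3 * Complex.I : ℂ) :=
    (isOpen_lt continuous_const Complex.continuous_re).mem_nhds (by simp)
  filter_upwards [h1, isOpen_tiltedRegion.mem_nhds hz] with s hs hsU
  have hsum : Summable fun i : ℕ => cpowRemainder ((i : ℝ) + 1) s :=
    summable_add_one_rpow.of_norm_bounded fun i => norm_cpowRemainder_le_of_mem i hsU
  rw [tendsto_nhds_unique hsum.hasSum.tendsto_sum_nat (tendsto_sum_cpowRemainder hs)]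
  ring

/-- The derivatives at `-1` of the Euler–Maclaurin remainders are, up to sign, the increments in `n`
of the displayed expression. -/
theorem tendsto_sum_mul_log :
    Tendsto (fun n : ℕ => (∑ ν ∈ Finset.Icc 1 n, (ν : ℝ) * Real.log ν)
      - (((n : ℝ) ^ 2 / 2 + n / 2 + 1 / 12) * Real.log n - (n : ℝ) ^ 2 / 4)) atTop
      (𝓝 (1 / 12 - (deriv riemannZeta (-1)).re)) := by
  have hG := Complex.hasSum_deriv_of_summable_norm summable_add_one_rpow differentiableOn_cpowRemainder
    isOpen_tiltedRegion (fun i s hs => norm_cpowRemainder_le_of_mem i hs) neg_one_mem_tiltedRegion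
  have hdiff := (Complex.differentiableOn_tsum_of_summable_norm summable_add_one_rpow
    differentiableOn_cpowRemainder isOpen_tiltedRegion
    fun i s hs => norm_cpowRemainder_le_of_mem i hs).differentiableAt
    (isOpen_tiltedRegion.mem_nhds neg_one_mem_tiltedRegion)
  have hzeta : deriv riemannZeta (-1) = -1 / 4 + 1 / 12
      + deriv (fun s => ∑' i : ℕ, cpowRemainder ((i : ℝ) + 1) s) (-1) := by
    rw [(Filter.eventuallyEq_of_mem (isOpen_tiltedRegion.mem_nhds neg_one_mem_tiltedRegion)
      riemannZeta_eq_on_tiltedRegion).deriv_eq]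
    have h1 : HasDerivAt (fun s : ℂ => 1 / (s - 1) + 1 / 2 + s / 12) (-1 / 4 + 1 / 12) (-1) := by
      have h2 := (((hasDerivAt_id (-1 : ℂ)).sub_const 1).inv (by norm_num)).add_const (1 / 2)
      refine ((h2.add ((hasDerivAt_id (-1 : ℂ)).div_const 12)).congr_of_eventuallyEq
        (Eventually.of_forall fun s => ?_)).congr_deriv ?_
      · simp
      · norm_num
    exact (h1.add hdiff.hasDerivAt).deriv
  simp only [fun i : ℕ => (hasDerivAt_cpowRemainder_neg_one (a := (i : ℝ) + 1)
    (by positivity)).deriv] at hG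
  have hre := ((Complex.hasSum_re hG).tendsto_sum_nat).comp (tendsto_sub_atTop_nat 1)
  simp only [Complex.ofReal_re] at hre
  rw [← sub_eq_iff_eq_add'.2 hzeta] at hre
  -- `1 / 4` is the value of the expression at `n = 1`; the intervals from `1` to `n` number `n -
  -- 1`.
  refine (hre.const_sub (1 / 4)).congr' ?_ |>.trans_eq ?_
  · filter_upwards [eventually_ge_atTop 1] with n hn
    obtain ⟨N, rfl⟩ : ∃ N, n = N + 1 := ⟨n - 1, by lia⟩
    simp only [Function.comp, Nat.add_sub_cancel]
    clear hn
    induction N with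
    | zero => simp
    | succ N ih =>
      rw [Finset.sum_range_succ, Finset.sum_Icc_succ_top (by lia)]
      push_cast at ih ⊢
      linarith
  · congr 1
    simp
    norm_num
    ring

/-! ### The products of factorials and the constants `F_k` -/

theorem isEquivalent_of_tendsto_log_sub_log {f g : ℕ → ℝ} (hf : ∀ᶠ n in atTop, 0 < f n)
    (hg : ∀ᶠ n in atTop, 0 < g n)
    (h : Tendsto (fun n => Real.log (f n) - Real.log (g n)) atTop (𝓝 0)) : f ~[atTop] g := by
  refine (isEquivalent_iff_tendsto_one (hg.mono fun n hn => hn.ne')).2 ?_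
  have h1 := (Real.continuous_exp.tendsto 0).comp h
  rw [Real.exp_zero] at h1
  refine h1.congr' ?_
  filter_upwards [hf, hg] with n hfn hgn
  simp [Real.exp_sub, Real.exp_log hfn, Real.exp_log hgn]

theorem tendsto_sum_inv_sub_log :
    Tendsto (fun n : ℕ => (∑ ν ∈ Finset.Icc 1 n, (ν : ℝ)⁻¹) - Real.log n) atTop
      (𝓝 Real.eulerMascheroniConstant) := by
  refine Real.tendsto_harmonic_sub_log.congr fun n => ?_
  rw [harmonic_eq_sum_Icc]
  push_cast
  rfl

theorem sum_Icc_one_eq_sum_range (f : ℕ → ℝ) (n : ℕ) :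
    ∑ ν ∈ Finset.Icc 1 n, f ν = ∑ i ∈ Finset.range n, f (i + 1) := by
  rw [Finset.range_eq_Ico, Finset.sum_Ico_add' f 0 n 1]
  rfl

/-- `log n!` by Stirling's series, up to its second term. -/
theorem log_factorial_eq {n : ℕ} (hn : n ≠ 0) :
    Real.log (n ! : ℝ) = n * Real.log n - n + (Real.log (2 * Real.pi) + Real.log n) / 2
      + 1 / 12 * (n : ℝ)⁻¹ + stirlingTail 2 n := by
  have hb : (bernoulli 2 : ℝ) = 1 / 6 := by
    rw [bernoulli_eq_bernoulli'_of_ne_one (by norm_num), bernoulli'_two]; norm_num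
  have hn' : (n : ℝ) ≠ 0 := by exact_mod_cast hn
  simp only [stirlingTail, stirlingRemainder, stirlingTerm]
  rw [Real.log_mul (by positivity) hn']
  norm_num [hb]
  ring

/-- The constant `F_k` of the product `∏ (k ν)!`. -/
noncomputable def factorialProductConstant (k : ℕ) : ℝ :=
  Real.exp (Real.eulerMascheroniConstant / (12 * (k : ℝ)) + ∑' ν : ℕ, stirlingTail 2 (k * (ν + 1)))

theorem log_factorialProductConstant (k : ℕ) : Real.log (factorialProductConstant k)
    = Real.eulerMascheroniConstant / (12 * (k : ℝ)) + ∑' ν : ℕ, stirlingTail 2 (k * (ν + 1)) :=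
  Real.log_exp _

theorem factorialProductConstant_pos (k : ℕ) : 0 < factorialProductConstant k := Real.exp_pos _

theorem summable_stirlingTail_mul_add_one {k : ℕ} (hk : k ≠ 0) :
    Summable fun ν : ℕ => stirlingTail 2 (k * (ν + 1)) :=
  summable_stirlingTail (Z := fun j => zetaOdd j / (k : ℝ) ^ (2 * j - 1))
    (fun ν => by positivity) (by norm_num) (hasSum_mul_add_one le_rfl k)

theorem isEnvelopingDivergentSum_log_factorialProductConstant {k : ℕ} (hk : k ≠ 0) :
    IsEnvelopingDivergentSum 2
      (fun j : ℕ => (bernoulli (2 * j) : ℝ) * zetaOdd j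
        / (2 * (j : ℝ) * (2 * (j : ℝ) - 1) * (k : ℝ) ^ (2 * j - 1)))
      (Real.log (factorialProductConstant k) - Real.eulerMascheroniConstant / (12 * (k : ℝ))) := by
  rw [log_factorialProductConstant, add_sub_cancel_left]
  have h := isEnvelopingDivergentSum_tsum_stirlingTail (x := fun ν : ℕ => k * (ν + 1))
    (Z := fun j => zetaOdd j / (k : ℝ) ^ (2 * j - 1)) (fun ν => by positivity)
    fun j hj => hasSum_mul_add_one hj k
  convert! h using 2 with j
  rw [mul_div_assoc', div_div, mul_comm ((k : ℝ) ^ _)]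

/-- Stirling's formula at each `kν`; the terms `(log ν) / 2` reassemble into `log n!`, to which
Stirling applies once more, giving the powers `1 / 4` of `2π` and `n`. -/
theorem sum_log_factorial_mul {k : ℕ} (hk : k ≠ 0) (n : ℕ) :
    ∑ ν ∈ Finset.Icc 1 n, Real.log ((k * ν)! : ℝ)
      = k * (∑ ν ∈ Finset.Icc 1 n, (ν : ℝ) * Real.log ν)
        + (k * Real.log k - k) * (n * (n + 1) / 2)
        + n / 2 * (Real.log (2 * Real.pi) + Real.log k) + Real.log (n ! : ℝ) / 2
        + 1 / (12 * k) * (∑ ν ∈ Finset.Icc 1 n, (ν : ℝ)⁻¹)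
        + ∑ ν ∈ Finset.range n, stirlingTail 2 (k * (ν + 1)) := by
  have hk' : (k : ℝ) ≠ 0 := by exact_mod_cast hk
  induction n with
  | zero => simp
  | succ n ih =>
    have hn' : (n : ℝ) + 1 ≠ 0 := by positivity
    rw [Finset.sum_Icc_succ_top (by lia), Finset.sum_Icc_succ_top (by lia),
      Finset.sum_Icc_succ_top (by lia), Finset.sum_range_succ, ih,
      log_factorial_eq (mul_ne_zero hk n.succ_ne_zero), Nat.factorial_succ]
    push_cast
    rw [Real.log_mul hk' hn', Real.log_mul (x := (n : ℝ) + 1) hn' (by positivity), mul_inv]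
    field_simp
    ring

theorem isEquivalent_prod_factorial_mul {k : ℕ} (hk : k ≠ 0) :
    (fun n : ℕ => ∏ ν ∈ Finset.Icc 1 n, (((k * ν)! : ℕ) : ℝ)) ~[atTop]
      (fun n : ℕ =>
        factorialProductConstant k * glaisherKinkelin ^ k * (2 * Real.pi) ^ (1 / 4 : ℝ)
          * ((k : ℝ) * n / Real.exp (3 / 2)) ^ ((k : ℝ) / 2 * n * (n + 1))
          * (2 * Real.pi * k * Real.exp ((k : ℝ) / 2 - 1) * n) ^ ((n : ℝ) / 2)
          * (n : ℝ) ^ (1 / 4 + (k : ℝ) / 12 + 1 / (12 * (k : ℝ)))) := by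
  have hk' : (0 : ℝ) < k := by positivity
  have hF := factorialProductConstant_pos k
  have hA : 0 < glaisherKinkelin := Real.exp_pos _
  have hpi := Real.pi_pos
  refine isEquivalent_of_tendsto_log_sub_log (Eventually.of_forall fun n => by positivity) ?_ ?_
  · filter_upwards [eventually_ne_atTop 0] with n hn
    positivity
  have h1 := (tendsto_sum_mul_log.sub_const (1 / 12 - (deriv riemannZeta (-1)).re)).const_mul (k : ℝ)
  have h2 := tendsto_stirlingRemainder.div_const 2
  have h3 := (tendsto_sum_inv_sub_log.sub_const Real.eulerMascheroniConstant).const_mul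
    (1 / (12 * (k : ℝ)))
  have h4 := (summable_stirlingTail_mul_add_one hk).hasSum.tendsto_sum_nat.sub_const
    (∑' ν : ℕ, stirlingTail 2 (k * (ν + 1)))
  have h := ((h1.add h2).add h3).add h4
  simp only [sub_self, mul_zero, zero_div, add_zero] at h
  refine h.congr' ?_
  filter_upwards [eventually_ne_atTop 0] with n hn
  have hn' : (0 : ℝ) < n := by positivity
  have hR : Real.log (factorialProductConstant k * glaisherKinkelin ^ k
        * (2 * Real.pi) ^ (1 / 4 : ℝ)
        * ((k : ℝ) * n / Real.exp (3 / 2)) ^ ((k : ℝ) / 2 * n * (n + 1))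
        * (2 * Real.pi * k * Real.exp ((k : ℝ) / 2 - 1) * n) ^ ((n : ℝ) / 2)
        * (n : ℝ) ^ (1 / 4 + (k : ℝ) / 12 + 1 / (12 * (k : ℝ))))
      = Real.log (factorialProductConstant k) + k * Real.log glaisherKinkelin
        + 1 / 4 * Real.log (2 * Real.pi)
        + (k : ℝ) / 2 * n * (n + 1) * (Real.log k + Real.log n - 3 / 2)
        + (n : ℝ) / 2 * (Real.log (2 * Real.pi) + Real.log k + ((k : ℝ) / 2 - 1) + Real.log n)
        + (1 / 4 + (k : ℝ) / 12 + 1 / (12 * (k : ℝ))) * Real.log n := by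
    rw [Real.log_mul (by positivity) (by positivity), Real.log_mul (by positivity) (by positivity),
      Real.log_mul (by positivity) (by positivity), Real.log_mul (by positivity) (by positivity),
      Real.log_mul (by positivity) (by positivity), Real.log_pow, Real.log_rpow (by positivity),
      Real.log_rpow (by positivity), Real.log_rpow (by positivity), Real.log_rpow (by positivity),
      Real.log_div (by positivity) (by positivity), Real.log_exp, Real.log_mul hk'.ne' hn'.ne',
      Real.log_mul (y := (n : ℝ)) (by positivity) hn'.ne',
      Real.log_mul (y := Real.exp _) (by positivity) (by positivity), Real.log_exp,
      Real.log_mul (y := (k : ℝ)) (by positivity) hk'.ne']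
  rw [hR, Real.log_prod (fun ν _ => by positivity), sum_log_factorial_mul hk,
    log_factorialProductConstant, glaisherKinkelin, Real.log_exp, stirlingRemainder,
    Real.log_mul (y := (n : ℝ)) (by positivity) hn'.ne']
  field_simp
  ring

/-! ### Limits in `k` and the product of the `F_k` -/

/-- Each remainder is bounded by its first term, which is homogeneous of degree `-3`. Hence `log F_k
= γ / (12k) + O(k⁻³)`, which gives both limits. -/
theorem abs_tsum_stirlingTail_le {k : ℕ} (hk : k ≠ 0) :
    |∑' ν : ℕ, stirlingTail 2 (k * (ν + 1))|
      ≤ (∑' ν : ℕ, |stirlingTerm 2 ((ν + 1 : ℕ) : ℝ)|) * ((k : ℝ) ^ 3)⁻¹ := by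
  have hs : Summable fun ν : ℕ => |stirlingTerm 2 ((ν + 1 : ℕ) : ℝ)| :=
    (hasSum_stirlingTerm (x := fun ν => ν + 1) (hasSum_zetaOdd le_rfl)).summable.abs
  rw [← tsum_mul_right]
  refine (norm_tsum_le_tsum_norm (summable_stirlingTail_mul_add_one hk).norm).trans ?_
  refine (summable_stirlingTail_mul_add_one hk).norm.tsum_le_tsum (fun ν => ?_) (hs.mul_right _)
  refine (abs_stirlingTail_le (by norm_num) (by positivity)).trans_eq ?_
  rw [← abs_of_nonneg (by positivity : (0 : ℝ) ≤ ((k : ℝ) ^ 3)⁻¹), ← abs_mul]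
  congr 1
  simp only [stirlingTerm]
  push_cast
  field_simp

theorem tendsto_mul_log_factorialProductConstant :
    Tendsto (fun k : ℕ => k * Real.log (factorialProductConstant k)) atTop
      (𝓝 (Real.eulerMascheroniConstant / 12)) := by
  set C := ∑' ν : ℕ, |stirlingTerm 2 ((ν + 1 : ℕ) : ℝ)| with hC
  have h0 : Tendsto (fun k : ℕ => k * ∑' ν : ℕ, stirlingTail 2 (k * (ν + 1))) atTop (𝓝 0) := by
    have hlim : Tendsto (fun k : ℕ => C * (((k : ℝ) ^ 2))⁻¹) atTop (𝓝 0) := by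
      have := (((tendsto_pow_atTop two_ne_zero).comp
        tendsto_natCast_atTop_atTop).inv_tendsto_atTop (𝕜 := ℝ)).const_mul C
      rwa [mul_zero] at this
    refine squeeze_zero_norm' ?_ hlim
    filter_upwards [eventually_ne_atTop 0] with k hk
    have hk' : (0 : ℝ) < k := by positivity
    rw [Real.norm_eq_abs, abs_mul, abs_of_pos hk']
    refine (mul_le_mul_of_nonneg_left (abs_tsum_stirlingTail_le hk) hk'.le).trans_eq ?_
    rw [← hC]
    field_simp
  have h := h0.const_add (Real.eulerMascheroniConstant / 12)
  rw [add_zero] at h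
  refine h.congr' ?_
  filter_upwards [eventually_ne_atTop 0] with k hk
  have hk' : (0 : ℝ) < k := by positivity
  rw [log_factorialProductConstant]
  field_simp

theorem tendsto_factorialProductConstant_pow :
    Tendsto (fun k : ℕ => factorialProductConstant k ^ k) atTop
      (𝓝 (Real.exp (Real.eulerMascheroniConstant / 12))) := by
  refine ((Real.continuous_exp.tendsto _).comp
    tendsto_mul_log_factorialProductConstant).congr fun k => ?_
  simp only [Function.comp]
  rw [Real.exp_nat_mul, Real.exp_log (factorialProductConstant_pos k)]

theorem tendsto_factorialProductConstant : Tendsto factorialProductConstant atTop (𝓝 1) := by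
  have h := tendsto_mul_log_factorialProductConstant.mul
    (tendsto_inv_atTop_nhds_zero_nat (𝕜 := ℝ))
  rw [mul_zero] at h
  have h2 := (Real.continuous_exp.tendsto _).comp h
  rw [Real.exp_zero] at h2
  refine h2.congr' ?_
  filter_upwards [eventually_ne_atTop 0] with k hk
  have hk' : (k : ℝ) ≠ 0 := by positivity
  simp only [Function.comp]
  rw [mul_comm, inv_mul_cancel_left₀ hk', Real.exp_log (factorialProductConstant_pos k)]

theorem summable_stirlingTail_mul :
    Summable fun p : ℕ × ℕ => stirlingTail 2 ((p.1 + 1) * (p.2 + 1)) :=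
  summable_stirlingTail (Z := fun j => zetaOdd j ^ 2) (fun p => by positivity) (by norm_num)
    (hasSum_add_one_mul_add_one le_rfl)

/-- The constant `F_∞` of the product `∏ F_k`. -/
noncomputable def factorialProductConstantInf : ℝ :=
  Real.exp (Real.eulerMascheroniConstant ^ 2 / 12
    + ∑' p : ℕ × ℕ, stirlingTail 2 ((p.1 + 1) * (p.2 + 1)))

theorem isEnvelopingDivergentSum_log_factorialProductConstantInf :
    IsEnvelopingDivergentSum 2
      (fun j : ℕ => (bernoulli (2 * j) : ℝ) * zetaOdd j ^ 2 / (2 * (j : ℝ) * (2 * (j : ℝ) - 1)))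
      (Real.log factorialProductConstantInf - Real.eulerMascheroniConstant ^ 2 / 12) := by
  rw [factorialProductConstantInf, Real.log_exp, add_sub_cancel_left]
  exact isEnvelopingDivergentSum_tsum_stirlingTail (Z := fun j => zetaOdd j ^ 2)
    (x := fun p : ℕ × ℕ => (p.1 + 1) * (p.2 + 1)) (fun p => by positivity)
    fun j hj => hasSum_add_one_mul_add_one hj

theorem isEquivalent_prod_factorialProductConstant :
    (fun n : ℕ => ∏ k ∈ Finset.Icc 1 n, factorialProductConstant k) ~[atTop]
      (fun n : ℕ => factorialProductConstantInf * (n : ℝ) ^ (Real.eulerMascheroniConstant / 12)) := by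
  have hF : 0 < factorialProductConstantInf := Real.exp_pos _
  refine isEquivalent_of_tendsto_log_sub_log
    (Eventually.of_forall fun n => Finset.prod_pos fun k _ => factorialProductConstant_pos k) ?_ ?_
  · filter_upwards [eventually_ne_atTop 0] with n hn
    positivity
  have h1 := (tendsto_sum_inv_sub_log.sub_const Real.eulerMascheroniConstant).const_mul
    (Real.eulerMascheroniConstant / 12)
  -- Absolute convergence lets the double series be summed by rows, the rows being the tail sums in
  -- `log F_k`. The remaining `∑ γ / (12k)` supplies `(γ / 12) log n` and `γ² / 12`.
  have h2 := (summable_stirlingTail_mul.hasSum.prod_fiberwise fun k =>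
    (summable_stirlingTail_mul_add_one k.succ_ne_zero).hasSum).tendsto_sum_nat.sub_const
      (∑' p : ℕ × ℕ, stirlingTail 2 ((p.1 + 1) * (p.2 + 1)))
  have h := h1.add h2
  simp only [sub_self, mul_zero, add_zero] at h
  refine h.congr' ?_
  filter_upwards [eventually_ne_atTop 0] with n hn
  have hn' : (0 : ℝ) < n := by positivity
  rw [Real.log_prod (fun k _ => (factorialProductConstant_pos k).ne'),
    Real.log_mul hF.ne' (by positivity), Real.log_rpow hn', factorialProductConstantInf,
    Real.log_exp]
  simp only [log_factorialProductConstant, Finset.sum_add_distrib]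
  rw [sum_Icc_one_eq_sum_range (fun k => ∑' ν : ℕ, stirlingTail 2 (k * (ν + 1)))]
  have h3 : ∑ k ∈ Finset.Icc 1 n, Real.eulerMascheroniConstant / (12 * (k : ℝ))
      = Real.eulerMascheroniConstant / 12 * ∑ k ∈ Finset.Icc 1 n, (k : ℝ)⁻¹ := by
    rw [Finset.mul_sum]
    exact Finset.sum_congr rfl fun k _ => by rw [← div_div, div_eq_mul_inv]
  rw [h3]
  ring

theorem mainTheorem1 :
    ∃ F : ℕ → ℝ,
      (∀ k : ℕ, 1 ≤ k →
        0 < F k ∧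
        (fun n : ℕ => ∏ ν ∈ Finset.Icc 1 n, (((k * ν)! : ℕ) : ℝ)) ~[atTop]
          (fun n : ℕ =>
            F k * glaisherKinkelin ^ k * (2 * Real.pi) ^ (1 / 4 : ℝ)
              * ((k : ℝ) * n / Real.exp (3 / 2)) ^ ((k : ℝ) / 2 * n * (n + 1))
              * (2 * Real.pi * k * Real.exp ((k : ℝ) / 2 - 1) * n) ^ ((n : ℝ) / 2)
              * (n : ℝ) ^ (1 / 4 + (k : ℝ) / 12 + 1 / (12 * (k : ℝ)))) ∧
        IsEnvelopingDivergentSum 2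
          (fun j : ℕ => (bernoulli (2 * j) : ℝ) * zetaOdd j
            / (2 * (j : ℝ) * (2 * (j : ℝ) - 1) * (k : ℝ) ^ (2 * j - 1)))
          (Real.log (F k) - Real.eulerMascheroniConstant / (12 * (k : ℝ)))) ∧
      Tendsto F atTop (𝓝 1) ∧
      Tendsto (fun k : ℕ => F k ^ k) atTop (𝓝 (Real.exp (Real.eulerMascheroniConstant / 12))) ∧
      ∃ Finf : ℝ,
        0 < Finf ∧
        (fun n : ℕ => ∏ k ∈ Finset.Icc 1 n, F k) ~[atTop]
          (fun n : ℕ => Finf * (n : ℝ) ^ (Real.eulerMascheroniConstant / 12)) ∧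
        IsEnvelopingDivergentSum 2
          (fun j : ℕ => (bernoulli (2 * j) : ℝ) * zetaOdd j ^ 2
            / (2 * (j : ℝ) * (2 * (j : ℝ) - 1)))
          (Real.log Finf - Real.eulerMascheroniConstant ^ 2 / 12) := by
  refine ⟨factorialProductConstant, fun k hk => ⟨factorialProductConstant_pos k,
    isEquivalent_prod_factorial_mul (by lia),
    isEnvelopingDivergentSum_log_factorialProductConstant (by lia)⟩,
    tendsto_factorialProductConstant, tendsto_factorialProductConstant_pow,
    factorialProductConstantInf, Real.exp_pos _, isEquivalent_prod_factorialProductConstant,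
    isEnvelopingDivergentSum_log_factorialProductConstantInf⟩
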